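/- Let $n,m\in\mathbb{Z}_{\geq 0}$ and $\theta>0$. Let $\Lambda_{n,m,\theta}$ be the algebra of all polynomials $p(z,w)\in\mathbb{C}[z_1,\dots,z_n,w_1,\dots,w_m]$ that are invariant under permutations of $z_1,\dots,z_n$, invariant under permutations of $w_1,\dots,w_m$, and satisfy $$\left.\left(\frac{\partial}{\partial z_j}+\theta\frac{\partial}{\partial w_k}\right)p(z,w)\right|_{z_j=w_k}\equiv 0\qquad (1\le j\le n,\ 1\le k\le m).$$ For $\xi>0$ let $T^n_\xi=\{z\in\mathbb{C}^n: |z_j|=\xi,\ j=1,\dots,n\}$ and $d\omega_n(z)=\frac{1}{(2\pi i)^n}\frac{dz_1}{z_1}\cdots\frac{dz_n}{z_n}$. Put $$\Delta_n(z;\theta)=\prod_{1\le j<k\le n}\big[(1-z_j/z_k)(1-z_k/z_j)\big]^\theta,\qquad \Delta_{n,m}(z,w;\theta)=\frac{\Delta_n(z;\theta)\,\Delta_m(w;1/\theta)}{\prod_{j=1}^n\prod_{k=1}^m(1-z_j/w_k)(1-w_k/z_j)},$$ where on the tori the bases of the powers are non-negative real numbers, and, for a polynomial $q$, put $q^*(z,w)=\overline{q(1/\bar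 z_1,\dots,1/\bar z_n,1/\bar w_1,\dots,1/\bar w_m)}$. For $p,q\in\Lambda_{n,m,\theta}$ and $\xi'>\xi>0$ let $$\langle p,q\rangle'_{n,m,\theta}=\frac{1}{n!\,m!}\int_{T^n_\xi}d\omega_n(z)\int_{T^m_{\xi'}}d\omega_m(w)\,\Delta_{n,m}(z,w;\theta)\,p(z,w)\,q^*(z,w).$$ Then for all $p,q\in\Lambda_{n,m,\theta}$ the integral converges absolutely whenever $\xi'>\xi>0$, and the value $\langle p,q\rangle'_{n,m,\theta}$ is independent of $\xi,\xi'>0$ provided that $\xi'>\xi$. -/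

import Mathlib

open MvPolynomial

noncomputable section

namespace SuperJack

/-- Polynomials `p(z, w)` with complex coefficients in the variables `z₁, …, zₙ`
(index `Sum.inl j`) and `w₁, …, w_m` (index `Sum.inr k`). -/
abbrev Poly (n m : ℕ) : Type := MvPolynomial (Fin n ⊕ Fin m) ℂ

/-- The restriction of a polynomial to the hyperplane `z_j = w_k`, obtained by substituting
`z_j` for `w_k`. -/
def restrict {n m : ℕ} (j : Fin n) (k : Fin m) : Poly n m →ₐ[ℂ] Poly n m :=
  rename (Function.update id (Sum.inr k) (Sum.inl j))

/-- The algebra `Λ_{n,m,θ}` of polynomials that are invariant under permutations of the `z_j`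
and under permutations of the `w_k`, and that satisfy the quasi-invariance condition
`(∂/∂z_j + θ ∂/∂w_k) p = 0` on `z_j = w_k`, for all `j` and `k`. -/
def Lam (n m : ℕ) (θ : ℝ) : Subalgebra ℂ (Poly n m) where
  carrier := {p |
    (∀ (σ : Equiv.Perm (Fin n)) (τ : Equiv.Perm (Fin m)),
      rename (Equiv.sumCongr σ τ) p = p) ∧
    (∀ (j : Fin n) (k : Fin m),
      restrict j k (pderiv (Sum.inl j) p + (θ : ℂ) • pderiv (Sum.inr k) p) = 0)}
  mul_mem' := by
    rintro p q ⟨hp, hp'⟩ ⟨hq, hq'⟩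
    refine ⟨fun σ τ => by rw [map_mul, hp, hq], fun j k => ?_⟩
    have h1 := hp' j k
    have h2 := hq' j k
    simp only [Derivation.leibniz, map_add, map_mul, smul_eq_mul, smul_eq_C_mul]
      at h1 h2 ⊢
    linear_combination (restrict j k p) * h2 + (restrict j k q) * h1
  add_mem' := by
    rintro p q ⟨hp, hp'⟩ ⟨hq, hq'⟩
    refine ⟨fun σ τ => by rw [map_add, hp, hq], fun j k => ?_⟩
    have h1 := hp' j k
    have h2 := hq' j k
    simp only [map_add, map_mul, smul_eq_C_mul] at h1 h2 ⊢
    linear_combination h1 + h2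
  algebraMap_mem' := by
    intro c
    refine ⟨fun σ τ => by simp, fun j k => by simp⟩

/-- The value `p(z, w)`. -/
def ev {n m : ℕ} (p : Poly n m) (z : Fin n → ℂ) (w : Fin m → ℂ) : ℂ :=
  eval (Sum.elim z w) p

/-- The conjugate `p^*(z, w)`, the complex conjugate of
`p(1 / conj z₁, …, 1 / conj zₙ, 1 / conj w₁, …, 1 / conj w_m)`. -/
def evStar {n m : ℕ} (p : Poly n m) (z : Fin n → ℂ) (w : Fin m → ℂ) : ℂ :=
  starRingEnd ℂ (ev p (fun j => (starRingEnd ℂ (z j))⁻¹) (fun k => (starRingEnd ℂ (w k))⁻¹))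

/-- The weight `Δ_n(z; θ) = ∏_{j < k} [(1 - z_j / z_k) (1 - z_k / z_j)] ^ θ`. When all `z_j` have
the same nonzero modulus, the base is the real number `|1 - z_j / z_k| ^ 2 ≥ 0`, so that the
principal power is the usual real power. -/
def weight (n : ℕ) (θ : ℝ) (z : Fin n → ℂ) : ℂ :=
  ∏ j : Fin n, ∏ k ∈ Finset.Ioi j, ((1 - z j / z k) * (1 - z k / z j)) ^ (θ : ℂ)

/-- The weight `Δ_{n,m}(z, w; θ)`. -/
def superWeight (n m : ℕ) (θ : ℝ) (z : Fin n → ℂ) (w : Fin m → ℂ) : ℂ :=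
  weight n θ z * weight m (1 / θ) w /
    ∏ j : Fin n, ∏ k : Fin m, ((1 - z j / w k) * (1 - w k / z j))

/-- The integral `∫_{T_ξ^n} f(z) dω_n(z)` over the torus `|z₁| = ⋯ = |zₙ| = ξ`, where
`dω_n(z) = (2πi)⁻ⁿ (dz₁ / z₁) ⋯ (dzₙ / zₙ)`. -/
def torusInt (n : ℕ) (ξ : ℝ) (f : (Fin n → ℂ) → ℂ) : ℂ :=
  (1 / (2 * (Real.pi : ℂ) * Complex.I) ^ n) *
    torusIntegral (fun z => (∏ j, z j)⁻¹ * f z) 0 (fun _ => ξ)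

/-- The integrand `Δ_{n,m}(z, w; θ) p(z, w) q^*(z, w)`. -/
def integrand (n m : ℕ) (θ : ℝ) (p q : Poly n m) (z : Fin n → ℂ) (w : Fin m → ℂ) : ℂ :=
  superWeight n m θ z w * ev p z w * evStar q z w

/-- The product `⟨p, q⟩'_{n,m,θ}`, computed with the tori `T_ξ^n` and `T_{ξ'}^m`. -/
def innerProd (n m : ℕ) (θ ξ ξ' : ℝ) (p q : Poly n m) : ℂ :=
  (1 / ((n.factorial : ℂ) * (m.factorial : ℂ))) *
    torusInt n ξ (fun z => torusInt m ξ' (fun w => integrand n m θ p q z w))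

/-- The integral defining `⟨p, q⟩'_{n,m,θ}` converges absolutely: the integrand is integrable
on `T_ξ^n × T_{ξ'}^m`, the tori being parametrized by angles in `[0, 2π]`. -/
def ProdIntegrable (n m : ℕ) (θ ξ ξ' : ℝ) (p q : Poly n m) : Prop :=
  MeasureTheory.IntegrableOn
    (fun a : (Fin n → ℝ) × (Fin m → ℝ) =>
      integrand n m θ p q (torusMap 0 (fun _ => ξ) a.1) (torusMap 0 (fun _ => ξ') a.2))
    (Set.Icc 0 (fun _ => 2 * Real.pi) ×ˢ Set.Icc 0 (fun _ => 2 * Real.pi))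

end SuperJack

end

noncomputable section

namespace SuperJack

open MeasureTheory Set

/-! The powers in the weights are not holomorphic in the single variables, so contours cannot be
moved one variable at a time. Instead all `z_j` are scaled by a common factor `s`. The weights are
homogeneous of degree zero (`weight_smul`), so for fixed angles the integrand depends on `s` only
through polynomials, inverses and the mixed denominator, and is holomorphic for `0 < |s| < ξ'`.
Rotating `s` translates the angles, so the torus integral equals its average over a circle in `s`,
and Cauchy's theorem on an annulus makes this independent of `|s|` (`integral_eq_of_rotation`). The
`w_k` are treated in the same way for `|s| > ξ`. Convergence holds because the integrand is
continuous on the compact product of tori: the mixed factors do not vanish there and the exponents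
are positive. -/

instance fact_two_pi_pos : Fact (0 < 2 * Real.pi) := ⟨Real.two_pi_pos⟩

/-- The circle `ℝ / 2πℤ` of angles. -/
abbrev Ang : Type := AddCircle (2 * Real.pi)

/-- The point `(s e^{i x₁}, …, s e^{i xₙ})`. -/
def torusPoint {n : ℕ} (s : ℂ) (x : Fin n → Ang) : Fin n → ℂ :=
  fun j => s * (AddCircle.toCircle (x j) : ℂ)

lemma coe_toCircle_coe (t : ℝ) :
    ((AddCircle.toCircle (t : Ang) : Circle) : ℂ) = Complex.exp (t * Complex.I) := by
  rw [AddCircle.toCircle_apply_mk, Circle.coe_exp, div_self Real.two_pi_pos.ne', one_mul]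

lemma torusPoint_coe {n : ℕ} (ξ : ℝ) (a : Fin n → ℝ) :
    torusPoint (ξ : ℂ) (fun j => (a j : Ang)) = torusMap 0 (fun _ => ξ) a := by
  funext j
  simp [torusPoint, torusMap, coe_toCircle_coe]

lemma torusPoint_add {n : ℕ} (s : ℂ) (x : Fin n → Ang) (α : Ang) :
    torusPoint s ((fun _ => α) + x) = torusPoint (s * (AddCircle.toCircle α : ℂ)) x := by
  funext j
  simp [torusPoint, AddCircle.toCircle_add, mul_assoc]

lemma continuous_coe_toCircle : Continuous fun x : Ang => (AddCircle.toCircle x : ℂ) :=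
  continuous_subtype_val.comp AddCircle.continuous_toCircle

lemma continuous_torusPoint {n : ℕ} (s : ℂ) : Continuous (torusPoint (n := n) s) :=
  continuous_pi fun j => continuous_const.mul (continuous_coe_toCircle.comp (continuous_apply j))

lemma torusPoint_ne_zero {n : ℕ} {s : ℂ} (hs : s ≠ 0) (x : Fin n → Ang) (j : Fin n) :
    torusPoint s x j ≠ 0 :=
  mul_ne_zero hs (Circle.coe_ne_zero _)

lemma norm_torusPoint {n : ℕ} (s : ℂ) (x : Fin n → Ang) (j : Fin n) :
    ‖torusPoint s x j‖ = ‖s‖ := by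
  rw [torusPoint, norm_mul, Circle.norm_coe, mul_one]

/-! ### Integrals over tori as integrals over angles -/

lemma measurePreserving_coe_pi (n : ℕ) :
    MeasurePreserving (fun (a : Fin n → ℝ) (j : Fin n) => (a j : Ang))
      (volume.restrict (Icc 0 fun _ => 2 * Real.pi)) volume := by
  have h := measurePreserving_pi (fun _ : Fin n => (volume : Measure ℝ).restrict
    (Ioc 0 (0 + 2 * Real.pi))) (fun _ : Fin n => (volume : Measure Ang))
    (fun _ => AddCircle.measurePreserving_mk (2 * Real.pi) 0)
  have e : Measure.pi (fun _ : Fin n => (volume : Measure ℝ).restrict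
      (Ioc 0 (0 + 2 * Real.pi))) = volume.restrict (Icc 0 fun _ => 2 * Real.pi) := by
    rw [← pi_univ_Icc, volume_pi, Measure.restrict_pi_pi]
    congr 1
    funext i
    rw [zero_add]
    exact Measure.restrict_congr_set Ioc_ae_eq_Icc
  rw [e] at h
  exact h

lemma torusInt_eq_integral {n : ℕ} {ξ : ℝ} (hξ : ξ ≠ 0) (f : (Fin n → ℂ) → ℂ)
    (hf : Continuous fun x : Fin n → Ang => f (torusPoint ξ x)) :
    torusInt n ξ f =
      (1 / (2 * (Real.pi : ℂ)) ^ n) * ∫ x : Fin n → Ang, f (torusPoint ξ x) := by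
  have hmp := measurePreserving_coe_pi n
  rw [← hmp.map_eq, integral_map hmp.measurable.aemeasurable
    (by exact hf.aestronglyMeasurable)]
  simp only [torusPoint_coe, torusInt, torusIntegral]
  -- Since `dz_j / z_j = i da_j`, the Jacobian cancels `∏ z_j` up to `i ^ n`, which in turn cancels
  -- against `(2πi)⁻ⁿ`.
  have key : ∀ a : Fin n → ℝ,
      (∏ i : Fin n, (ξ : ℂ) * Complex.exp (a i * Complex.I) * Complex.I) •
        ((∏ j, torusMap (0 : Fin n → ℂ) (fun _ => ξ) a j)⁻¹ * f (torusMap 0 (fun _ => ξ) a)) =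
      Complex.I ^ n * f (torusMap 0 (fun _ => ξ) a) := by
    intro a
    have hne : (∏ j, torusMap (0 : Fin n → ℂ) (fun _ => ξ) a j) ≠ 0 := by
      refine Finset.prod_ne_zero_iff.2 fun j _ => ?_
      simp [torusMap, hξ]
    have : (∏ i : Fin n, (ξ : ℂ) * Complex.exp (a i * Complex.I) * Complex.I) =
        (∏ j, torusMap (0 : Fin n → ℂ) (fun _ => ξ) a j) * Complex.I ^ n := by
      rw [Finset.prod_mul_distrib]
      simp [torusMap]
    rw [this, smul_eq_mul]
    field_simp
  simp only [key]
  rw [integral_const_mul, ← mul_assoc, mul_pow _ Complex.I]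
  congr 1
  have : Complex.I ^ n ≠ 0 := pow_ne_zero _ Complex.I_ne_zero
  field_simp

lemma integral_prod_of_continuous {X Y : Type*} [TopologicalSpace X] [TopologicalSpace Y]
    [CompactSpace X] [CompactSpace Y] [SecondCountableTopology X] [SecondCountableTopology Y]
    [MeasurableSpace X] [MeasurableSpace Y] [BorelSpace X] [BorelSpace Y]
    (μ : Measure X) (ν : Measure Y) [IsFiniteMeasure μ] [IsFiniteMeasure ν] {G : X × Y → ℂ}
    (hG : Continuous G) : ∫ a, G a ∂μ.prod ν = ∫ x, ∫ y, G (x, y) ∂ν ∂μ :=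
  integral_prod _ (hG.integrable_of_hasCompactSupport (HasCompactSupport.of_compactSpace _))

lemma torusInt_torusInt_eq_integral {n m : ℕ} {ξ ξ' : ℝ} (hξ : ξ ≠ 0) (hξ' : ξ' ≠ 0)
    (F : (Fin n → ℂ) → (Fin m → ℂ) → ℂ)
    (hF : Continuous fun a : (Fin n → Ang) × (Fin m → Ang) =>
      F (torusPoint ξ a.1) (torusPoint ξ' a.2)) :
    torusInt n ξ (fun z => torusInt m ξ' (fun w => F z w)) =
      (1 / (2 * (Real.pi : ℂ)) ^ n) * ((1 / (2 * (Real.pi : ℂ)) ^ m) *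
        ∫ a : (Fin n → Ang) × (Fin m → Ang), F (torusPoint ξ a.1) (torusPoint ξ' a.2)) := by
  have inner_eq : ∀ x : Fin n → Ang, torusInt m ξ' (fun w => F (torusPoint ξ x) w) =
      (1 / (2 * (Real.pi : ℂ)) ^ m) *
        ∫ y : Fin m → Ang, F (torusPoint ξ x) (torusPoint ξ' y) := by
    intro x
    have hx : Continuous fun y : Fin m → Ang => (x, y) := Continuous.prodMk_right x
    have := hF.comp hx
    simp only [Function.comp_def] at this
    exact torusInt_eq_integral hξ' _ this
  have hpar := continuous_parametric_integral_of_continuous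
    (μ := (volume : Measure (Fin m → Ang)))
    (f := fun x y => F (torusPoint ξ x) (torusPoint ξ' y)) hF isCompact_univ
  simp only [Measure.restrict_univ] at hpar
  rw [torusInt_eq_integral hξ _ (by simp only [inner_eq]; exact continuous_const.mul hpar)]
  simp only [inner_eq]
  rw [integral_const_mul, Measure.volume_eq_prod, integral_prod_of_continuous _ _ hF]

/-- Needed because the rotations act on only one of the two factors of the product torus. -/
instance isAddLeftInvariant_volume_torus (n m : ℕ) :
    (volume : Measure ((Fin n → Ang) × (Fin m → Ang))).IsAddLeftInvariant where
  map_add_left_eq_self g := by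
    rw [Measure.volume_eq_prod]
    exact ((measurePreserving_add_left volume g.1).prod (measurePreserving_add_left volume g.2)).map_eq

/-! ### Independence of the radius by averaging over rotations -/

lemma integral_ang_eq_circleIntegral (f : ℂ → ℂ) {r : ℝ} (hr : 0 < r) :
    ∫ α : Ang, f (r * (AddCircle.toCircle α : ℂ)) =
      Complex.I⁻¹ * ∮ z in C(0, r), (z - 0)⁻¹ • f z := by
  rw [← AddCircle.intervalIntegral_preimage (2 * Real.pi) 0, zero_add, circleIntegral,
    ← intervalIntegral.integral_const_mul]
  congr 1
  funext t
  have : Complex.exp (t * Complex.I) ≠ 0 := Complex.exp_ne_zero _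
  have hr' : (r : ℂ) ≠ 0 := by exact_mod_cast hr.ne'
  have hI := Complex.I_ne_zero
  simp only [coe_toCircle_coe, deriv_circleMap, circleMap, zero_add, sub_zero, smul_eq_mul]
  field_simp

/-- If a rotation of the parameter `s` amounts to a translation of the variable `x` and the
integrand is holomorphic in `s`, then its integral does not depend on `|s|`. -/
lemma integral_eq_of_rotation {X : Type*} [TopologicalSpace X] [AddGroup X]
    [IsTopologicalAddGroup X] [CompactSpace X] [SecondCountableTopology X]
    [MeasurableSpace X] [BorelSpace X]
    (μ : Measure X) [IsFiniteMeasure μ] [μ.IsAddLeftInvariant] {φ : Ang → X} (hφ : Continuous φ)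
    (H : ℂ → X → ℂ) (hH : ∀ s α x, H s (φ α + x) = H (s * (AddCircle.toCircle α : ℂ)) x)
    {r R : ℝ} (hr : 0 < r) (hrR : r ≤ R)
    (hcr : Continuous (H r)) (hcR : Continuous (H R))
    (hd : ∀ x, ∀ s : ℂ, r ≤ ‖s‖ → ‖s‖ ≤ R → DifferentiableAt ℂ (fun s => H s x) s) :
    ∫ x, H r x ∂μ = ∫ x, H R x ∂μ := by
  -- Translating by `φ α` does not change the integral, so integrating over `α` only multiplies it
  -- by `2π`; after the swap, the inner integral runs over the circle `|s| = ρ`.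
  have avg : ∀ ρ : ℝ, 0 < ρ → Continuous (H ρ) →
      (2 * Real.pi : ℝ) • ∫ x, H ρ x ∂μ =
        ∫ x, (Complex.I⁻¹ * ∮ z in C(0, ρ), (z - 0)⁻¹ • H z x) ∂μ := by
    intro ρ hρ hc
    have h1 : (2 * Real.pi : ℝ) • ∫ x, H ρ x ∂μ = ∫ α : Ang, ∫ x, H ρ (φ α + x) ∂μ := by
      simp only [integral_add_left_eq_self (μ := μ) (H ρ), integral_const, measureReal_def,
        AddCircle.measure_univ, ENNReal.toReal_ofReal Real.two_pi_pos.le]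
    have hc2 : Continuous (Function.uncurry fun (α : Ang) x => H ρ (φ α + x)) :=
      hc.comp ((hφ.comp continuous_fst).add continuous_snd)
    rw [h1, integral_integral_swap]
    · congr 1
      funext x
      simp only [hH]
      exact integral_ang_eq_circleIntegral (fun s => H s x) hρ
    · exact hc2.integrable_of_hasCompactSupport (HasCompactSupport.of_compactSpace _)
  have e : ∀ x, (∮ z in C(0, r), (z - 0)⁻¹ • H z x) = ∮ z in C(0, R), (z - 0)⁻¹ • H z x := by
    intro x
    refine (Complex.circleIntegral_sub_center_inv_smul_eq_of_differentiable_on_annulus_off_countable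
      hr hrR countable_empty ?_ ?_).symm
    · intro s hs
      refine (hd x s ?_ ?_).continuousAt.continuousWithinAt
      · simpa using hs.2
      · simpa using hs.1
    · intro s hs
      refine hd x s ?_ ?_
      · simpa using (not_le.1 (by simpa using hs.1.2 : ¬ ‖s‖ ≤ r)).le
      · simpa using (by simpa using hs.1.1 : ‖s‖ < R).le
  have := (avg r hr hcr).trans ((by simp only [e]) : _ = _) |>.trans
    (avg R (hr.trans_le hrR) hcR).symm
  exact smul_right_injective ℂ Real.two_pi_pos.ne' this

/-! ### The integrand -/

/-- Conjugating the coefficients removes the conjugation of the variables, so `q^*` is visibly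
holomorphic away from zero. -/
lemma evStar_eq_ev {n m : ℕ} (q : Poly n m) (z : Fin n → ℂ) (w : Fin m → ℂ) :
    evStar q z w = ev (map (starRingEnd ℂ) q) (fun j => (z j)⁻¹) (fun k => (w k)⁻¹) := by
  rw [evStar, ev, ev, eval_map, ← eval₂_id, eval₂_comp_left, RingHom.comp_id]
  congr 1
  funext i
  rcases i with j | k <;> simp

lemma differentiableAt_ev {n m : ℕ} (p : Poly n m) {f : ℂ → Fin n → ℂ} {g : ℂ → Fin m → ℂ} {s : ℂ}
    (hf : ∀ j, DifferentiableAt ℂ (fun s => f s j) s)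
    (hg : ∀ k, DifferentiableAt ℂ (fun s => g s k) s) :
    DifferentiableAt ℂ (fun s => ev p (f s) (g s)) s := by
  unfold ev
  simp only [eval_eq]
  have h : ∀ i : Fin n ⊕ Fin m, DifferentiableAt ℂ (fun s => Sum.elim (f s) (g s) i) s := by
    rintro (j | k)
    · exact hf j
    · exact hg k
  fun_prop

lemma continuous_ev {n m : ℕ} {X : Type*} [TopologicalSpace X] (p : Poly n m)
    {f : X → Fin n → ℂ} {g : X → Fin m → ℂ} (hf : Continuous f) (hg : Continuous g) :
    Continuous fun x => ev p (f x) (g x) := by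
  refine (MvPolynomial.continuous_eval p).comp (continuous_pi ?_)
  rintro (j | k)
  · exact (continuous_apply j).comp hf
  · exact (continuous_apply k).comp hg

lemma weight_smul (n : ℕ) (θ : ℝ) {s : ℂ} (hs : s ≠ 0) (z : Fin n → ℂ) :
    weight n θ (fun j => s * z j) = weight n θ z := by
  simp only [weight, mul_div_mul_left _ _ hs]

lemma continuous_weight_torusPoint (n : ℕ) {θ : ℝ} (hθ : 0 ≤ θ) {s : ℂ} (hs : s ≠ 0) :
    Continuous fun x : Fin n → Ang => weight n θ (torusPoint s x) := by
  -- On the torus each base is a squared modulus, so the complex power becomes a real one,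
  -- continuous even where the base vanishes since `0 ≤ θ`.
  have base : ∀ u v : Circle, (1 - (u : ℂ) / v) * (1 - (v : ℂ) / u) =
      ((‖1 - (u : ℂ) / v‖ ^ 2 : ℝ) : ℂ) := by
    intro u v
    push_cast
    rw [← Complex.mul_conj', map_sub, map_one, map_div₀, ← Circle.coe_inv_eq_conj,
      ← Circle.coe_inv_eq_conj, Circle.coe_inv, Circle.coe_inv]
    have := Circle.coe_ne_zero u
    have := Circle.coe_ne_zero v
    field_simp
  have e : ∀ x : Fin n → Ang, weight n θ (torusPoint s x) =
      ∏ j : Fin n, ∏ k ∈ Finset.Ioi j,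
        (((‖1 - (AddCircle.toCircle (x j) : ℂ) / AddCircle.toCircle (x k)‖ ^ 2) ^ θ : ℝ) : ℂ) := by
    intro x
    unfold torusPoint
    rw [weight_smul n θ hs]
    simp only [weight, base]
    refine Finset.prod_congr rfl fun j _ => Finset.prod_congr rfl fun k _ => ?_
    rw [Complex.ofReal_cpow (by positivity)]
  simp only [e]
  refine continuous_finsetProd _ fun j _ => continuous_finsetProd _ fun k _ =>
    Complex.continuous_ofReal.comp (Continuous.rpow_const ?_ fun _ => Or.inr hθ)
  refine ((continuous_const.sub (Continuous.div ?_ ?_ fun x => Circle.coe_ne_zero _)).norm).pow 2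
  · exact continuous_coe_toCircle.comp (continuous_apply j)
  · exact continuous_coe_toCircle.comp (continuous_apply k)

lemma mixed_factor_ne_zero {a b : ℂ} (ha : a ≠ 0) (hb : b ≠ 0) (h : a ≠ b) :
    (1 - a / b) * (1 - b / a) ≠ 0 := by
  refine mul_ne_zero (sub_ne_zero.2 fun e => h ?_) (sub_ne_zero.2 fun e => h ?_)
  · exact (div_eq_one_iff_eq hb).1 e.symm
  · exact ((div_eq_one_iff_eq ha).1 e.symm).symm

lemma continuous_integrand_torusPoint (n m : ℕ) {θ : ℝ} (hθ : 0 < θ) (p q : Poly n m) {s t : ℂ}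
    (hs : s ≠ 0) (ht : t ≠ 0) (hst : ‖s‖ ≠ ‖t‖) :
    Continuous fun a : (Fin n → Ang) × (Fin m → Ang) =>
      integrand n m θ p q (torusPoint s a.1) (torusPoint t a.2) := by
  have hz : Continuous fun a : (Fin n → Ang) × (Fin m → Ang) => torusPoint s a.1 :=
    (continuous_torusPoint s).comp continuous_fst
  have hw : Continuous fun a : (Fin n → Ang) × (Fin m → Ang) => torusPoint t a.2 :=
    (continuous_torusPoint t).comp continuous_snd
  have hzj := fun j => (continuous_apply j).comp hz
  have hwk := fun k => (continuous_apply k).comp hw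
  simp only [integrand, superWeight, evStar_eq_ev]
  refine ((Continuous.div ?_ ?_ ?_).mul (continuous_ev p hz hw)).mul (continuous_ev _ ?_ ?_)
  · exact ((continuous_weight_torusPoint n hθ.le hs).comp continuous_fst).mul
      ((continuous_weight_torusPoint m (one_div_pos.2 hθ).le ht).comp continuous_snd)
  · refine continuous_finsetProd _ fun j _ => continuous_finsetProd _ fun k _ => ?_
    exact (continuous_const.sub ((hzj j).div (hwk k) fun a => torusPoint_ne_zero ht _ _)).mul
      (continuous_const.sub ((hwk k).div (hzj j) fun a => torusPoint_ne_zero hs _ _))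
  · intro a
    refine Finset.prod_ne_zero_iff.2 fun j _ => Finset.prod_ne_zero_iff.2 fun k _ =>
      mixed_factor_ne_zero (torusPoint_ne_zero hs _ _) (torusPoint_ne_zero ht _ _) fun e => hst ?_
    rw [← norm_torusPoint s a.1 j, e, norm_torusPoint]
  · exact continuous_pi fun j => (hzj j).inv₀ fun a => torusPoint_ne_zero hs _ _
  · exact continuous_pi fun k => (hwk k).inv₀ fun a => torusPoint_ne_zero ht _ _

/-- Two scalings `f` and `g` cover both uses: one is the identity and the other constant. -/
lemma differentiableAt_integrand (n m : ℕ) (θ : ℝ) (p q : Poly n m) (x : Fin n → Ang)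
    (y : Fin m → Ang) {f g : ℂ → ℂ} {s : ℂ} (hf : DifferentiableAt ℂ f s)
    (hg : DifferentiableAt ℂ g s) (hf0 : f s ≠ 0) (hg0 : g s ≠ 0) (hfg : ‖f s‖ ≠ ‖g s‖) :
    DifferentiableAt ℂ
      (fun s => integrand n m θ p q (torusPoint (f s) x) (torusPoint (g s) y)) s := by
  have hz : ∀ j, DifferentiableAt ℂ (fun s => torusPoint (f s) x j) s := fun j => hf.mul_const _
  have hw : ∀ k, DifferentiableAt ℂ (fun s => torusPoint (g s) y k) s := fun k => hg.mul_const _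
  simp only [integrand, superWeight, evStar_eq_ev]
  refine ((DifferentiableAt.div (DifferentiableAt.mul ?_ ?_) ?_ ?_).mul
    (differentiableAt_ev p hz hw)).mul (differentiableAt_ev _ ?_ ?_)
  · refine (differentiableAt_const (weight n θ fun j => (AddCircle.toCircle (x j) : ℂ))
      ).congr_of_eventuallyEq ?_
    -- The weight is constant only where the scaling is nonzero, hence the restriction to a
    -- neighbourhood.
    filter_upwards [hf.continuousAt.eventually_ne hf0] with a ha
    exact weight_smul n θ ha _
  · refine (differentiableAt_const (weight m (1 / θ) fun k => (AddCircle.toCircle (y k) : ℂ))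
      ).congr_of_eventuallyEq ?_
    filter_upwards [hg.continuousAt.eventually_ne hg0] with a ha
    exact weight_smul m (1 / θ) ha _
  · refine DifferentiableAt.fun_finsetProd fun j _ => DifferentiableAt.fun_finsetProd fun k _ => ?_
    exact ((differentiableAt_const _).sub ((hz j).div (hw k) (torusPoint_ne_zero hg0 _ _))).mul
      ((differentiableAt_const _).sub ((hw k).div (hz j) (torusPoint_ne_zero hf0 _ _)))
  · refine Finset.prod_ne_zero_iff.2 fun j _ => Finset.prod_ne_zero_iff.2 fun k _ =>
      mixed_factor_ne_zero (torusPoint_ne_zero hf0 _ _) (torusPoint_ne_zero hg0 _ _) fun e => hfg ?_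
    rw [← norm_torusPoint (f s) x j, e, norm_torusPoint]
  · exact fun j => (hz j).inv (torusPoint_ne_zero hf0 _ _)
  · exact fun k => (hw k).inv (torusPoint_ne_zero hg0 _ _)

/-! ### Convergence and independence of the radii -/

lemma prodIntegrable (n m : ℕ) {θ : ℝ} (hθ : 0 < θ) (p q : Poly n m) {ξ ξ' : ℝ} (hξ : 0 < ξ)
    (h : ξ < ξ') : ProdIntegrable n m θ ξ ξ' p q := by
  have hξ' := hξ.trans h
  have hc := continuous_integrand_torusPoint n m hθ p q (s := ξ) (t := ξ')
    (by exact_mod_cast hξ.ne') (by exact_mod_cast hξ'.ne')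
    (by simpa [abs_of_pos hξ, abs_of_pos hξ'] using h.ne)
  have hcoe : ∀ l : ℕ, Continuous fun (a : Fin l → ℝ) (j : Fin l) => (a j : Ang) := fun l =>
    continuous_pi fun j => (AddCircle.continuous_mk' _).comp (continuous_apply j)
  have hcont := hc.comp (((hcoe n).comp continuous_fst).prodMk ((hcoe m).comp continuous_snd))
  refine ContinuousOn.integrableOn_compact (isCompact_Icc.prod isCompact_Icc)
    (Continuous.continuousOn ?_)
  simpa only [Function.comp_def, torusPoint_coe] using hcont

lemma innerProd_eq_integral (n m : ℕ) {θ : ℝ} (hθ : 0 < θ) (p q : Poly n m) {ξ ξ' : ℝ}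
    (hξ : 0 < ξ) (h : ξ < ξ') :
    innerProd n m θ ξ ξ' p q =
      (1 / ((n.factorial : ℂ) * (m.factorial : ℂ))) * ((1 / (2 * (Real.pi : ℂ)) ^ n) *
        ((1 / (2 * (Real.pi : ℂ)) ^ m) * ∫ a : (Fin n → Ang) × (Fin m → Ang),
          integrand n m θ p q (torusPoint ξ a.1) (torusPoint ξ' a.2))) := by
  have hξ' := hξ.trans h
  rw [innerProd, torusInt_torusInt_eq_integral hξ.ne' hξ'.ne' (integrand n m θ p q)
    (continuous_integrand_torusPoint n m hθ p q (s := ξ) (t := ξ')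
    (by exact_mod_cast hξ.ne') (by exact_mod_cast hξ'.ne')
    (by simpa [abs_of_pos hξ, abs_of_pos hξ'] using h.ne))]

lemma innerProd_inner_radius (n m : ℕ) {θ : ℝ} (hθ : 0 < θ) (p q : Poly n m) {r R ξ' : ℝ}
    (hr : 0 < r) (hrR : r ≤ R) (h : R < ξ') :
    innerProd n m θ r ξ' p q = innerProd n m θ R ξ' p q := by
  have hR := hr.trans_le hrR
  have hξ' := hR.trans h
  rw [innerProd_eq_integral n m hθ p q hr (hrR.trans_lt h), innerProd_eq_integral n m hθ p q hR h]
  congr 3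
  have hξ0 : (ξ' : ℂ) ≠ 0 := by exact_mod_cast hξ'.ne'
  have hcont : ∀ ρ : ℝ, 0 < ρ → ρ < ξ' → Continuous fun a : (Fin n → Ang) × (Fin m → Ang) =>
      integrand n m θ p q (torusPoint ρ a.1) (torusPoint ξ' a.2) := fun ρ h0 h1 =>
    continuous_integrand_torusPoint n m hθ p q (by exact_mod_cast h0.ne') hξ0
      (by simpa [abs_of_pos h0, abs_of_pos hξ'] using h1.ne)
  refine integral_eq_of_rotation (X := (Fin n → Ang) × (Fin m → Ang)) volume
    -- All `z`-angles turn together while the `w`-angles stay fixed.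
    (φ := fun α => (fun _ => α, 0)) (by fun_prop)
    (fun s a => integrand n m θ p q (torusPoint s a.1) (torusPoint ξ' a.2))
    ?_ hr hrR (hcont r hr (hrR.trans_lt h)) (hcont R hR h) ?_
  · intro s α a
    simp only [Prod.fst_add, Prod.snd_add, zero_add, torusPoint_add]
  · intro a s h1 h2
    refine differentiableAt_integrand n m θ p q a.1 a.2 differentiableAt_id
      (differentiableAt_const _) (norm_pos_iff.1 (hr.trans_le h1)) hξ0 ?_
    simpa [abs_of_pos hξ'] using (h2.trans_lt h).ne

lemma innerProd_outer_radius (n m : ℕ) {θ : ℝ} (hθ : 0 < θ) (p q : Poly n m) {ξ r R : ℝ}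
    (hξ : 0 < ξ) (h : ξ < r) (hrR : r ≤ R) :
    innerProd n m θ ξ r p q = innerProd n m θ ξ R p q := by
  have hr := hξ.trans h
  have hR := hr.trans_le hrR
  rw [innerProd_eq_integral n m hθ p q hξ h, innerProd_eq_integral n m hθ p q hξ (h.trans_le hrR)]
  congr 3
  have hξ0 : (ξ : ℂ) ≠ 0 := by exact_mod_cast hξ.ne'
  have hcont : ∀ ρ : ℝ, ξ < ρ → Continuous fun a : (Fin n → Ang) × (Fin m → Ang) =>
      integrand n m θ p q (torusPoint ξ a.1) (torusPoint ρ a.2) := fun ρ h1 =>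
    continuous_integrand_torusPoint n m hθ p q hξ0 (by exact_mod_cast (hξ.trans h1).ne')
      (by simpa [abs_of_pos hξ, abs_of_pos (hξ.trans h1)] using h1.ne)
  refine integral_eq_of_rotation (X := (Fin n → Ang) × (Fin m → Ang)) volume
    (φ := fun α => (0, fun _ => α)) (by fun_prop)
    (fun s a => integrand n m θ p q (torusPoint ξ a.1) (torusPoint s a.2))
    ?_ hr hrR (hcont r h) (hcont R (h.trans_le hrR)) ?_
  · intro s α a
    simp only [Prod.fst_add, Prod.snd_add, zero_add, torusPoint_add]
  · intro a s h1 _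
    refine differentiableAt_integrand n m θ p q a.1 a.2 (differentiableAt_const _)
      differentiableAt_id hξ0 (norm_pos_iff.1 (hr.trans_le h1)) ?_
    simpa [abs_of_pos hξ] using (h.trans_le h1).ne

/-- Both radii can be moved to a common pair: the smaller inner and the larger outer one. -/
lemma innerProd_shrink_grow (n m : ℕ) {θ : ℝ} (hθ : 0 < θ) (p q : Poly n m) {ξ ξ' r R : ℝ}
    (hr : 0 < r) (hrξ : r ≤ ξ) (h : ξ < ξ') (hR : ξ' ≤ R) :
    innerProd n m θ ξ ξ' p q = innerProd n m θ r R p q :=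
  (innerProd_inner_radius n m hθ p q hr hrξ h).symm.trans
    (innerProd_outer_radius n m hθ p q hr (hrξ.trans_lt h) hR)

end SuperJack

end

theorem lemma3p1 (n m : ℕ) (θ : ℝ) (hθ : 0 < θ)
    (p q : SuperJack.Poly n m) (hp : p ∈ SuperJack.Lam n m θ) (hq : q ∈ SuperJack.Lam n m θ) :
    (∀ ξ ξ' : ℝ, 0 < ξ → ξ < ξ' → SuperJack.ProdIntegrable n m θ ξ ξ' p q) ∧
    (∀ ξ₁ ξ₁' ξ₂ ξ₂' : ℝ, 0 < ξ₁ → ξ₁ < ξ₁' → 0 < ξ₂ → ξ₂ < ξ₂' →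
      SuperJack.innerProd n m θ ξ₁ ξ₁' p q = SuperJack.innerProd n m θ ξ₂ ξ₂' p q) := by
  refine ⟨fun ξ ξ' h0 h => SuperJack.prodIntegrable n m hθ p q h0 h,
    fun ξ₁ ξ₁' ξ₂ ξ₂' h1 h1' h2 h2' => ?_⟩
  -- Both pairs are compared with `(min ξ₁ ξ₂, max ξ₁' ξ₂')`.
  exact (SuperJack.innerProd_shrink_grow n m hθ p q (lt_min h1 h2) (min_le_left _ _) h1'
    (le_max_left _ _)).trans (SuperJack.innerProd_shrink_grow n m hθ p q (lt_min h1 h2)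
    (min_le_right _ _) h2' (le_max_right _ _)).symm
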